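/- Let $V$ be a $d$-dimensional Euclidean space, let $\Lambda\subset V$ be a lattice (a discrete additive subgroup spanning $V$), and let $\Lambda^*=\{x\in V:\langle x,y\rangle\in\mathbb Z\text{ for all }y\in\Lambda\}$ be its dual lattice. For $l\in\Lambda^*$ and a polytope $Q\subset V$ put $$\Phi_l(Q)=\int_Q \exp\{2\pi i\langle l,x\rangle\}\,dx,$$ where $dx$ is Lebesgue measure on $V$. A polytope is called a lattice polytope if its vertices belong to $\Lambda$, and rational if some positive integer multiple of it is a lattice polytope. For a face $F$ of a polytope, $\operatorname{lin}(F)$ is the linear subspace of $V$ parallel to the affine hull of $F$, so that $\dim\operatorname{lin}(F)=\dim F$; a polytope counts as a face of itself. Theorem. Let $P\subset V$ be a rational full-dimensional polytope and let $t$ be a positive integer such that $tP$ is a lattice polytope. Let $\varepsilon\ge 0$ be a rational number, let $a\in V$ and let $l\in\Lambda^*$. Then there exist functions $f_i:\mathbb N\to\mathbb C$, $i=0,\dots,d$ (depending on $P,\varepsilon,a,l$), such that $$\Phi_l\bigl((n+\varepsilon)P+a\bigr)=\sum_{i=0}^d f_i(n)\,n^i\quad\text{and}\quad f_i(n+t)=f_i(n)\qquad\text{for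 all } n\in\mathbb N \text{ and } i=0,\dots,d,$$ where $\mathbb N=\{0,1,2,\dots\}$ and $0^0=1$. Moreover, for any such functions $f_0,\dots,f_d$ and any integer $0\le k\le d$: if $f_{d-k}(n)\ne 0$ for some $n\in\mathbb N$, then there exists a $(d-k)$-dimensional face $F$ of $P$ such that $l$ is orthogonal to $\operatorname{lin}(F)$. -/

import Mathlib

open scoped Pointwise

noncomputable section

/-- `P` is a (nonempty) polytope: the convex hull of a nonempty finite set of points. -/
def IsPolytope {V : Type*} [AddCommGroup V] [Module ℝ V] (P : Set V) : Prop :=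
  ∃ S : Finset V, S.Nonempty ∧ P = convexHull ℝ (S : Set V)

/-- `P` is a lattice polytope with respect to `Λ`: all vertices (extreme points) of the polytope
`P` belong to `Λ`. -/
def IsLatticePolytope {V : Type*} [AddCommGroup V] [Module ℝ V]
    (Λ : Submodule ℤ V) (P : Set V) : Prop :=
  IsPolytope P ∧ P.extremePoints ℝ ⊆ (Λ : Set V)

/-- `P` is a rational polytope with respect to `Λ`: some positive integer dilate of the polytope
`P` is a lattice polytope. -/
def IsRationalPolytope {V : Type*} [AddCommGroup V] [Module ℝ V]
    (Λ : Submodule ℤ V) (P : Set V) : Prop :=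
  IsPolytope P ∧ ∃ t : ℕ, 0 < t ∧ IsLatticePolytope Λ ((t : ℝ) • P)

/-- `P` is full-dimensional: its affine hull is the whole space. -/
def IsFullDimensional {V : Type*} [AddCommGroup V] [Module ℝ V] (P : Set V) : Prop :=
  affineSpan ℝ P = ⊤

/-- The subspace `lin(F)` parallel to the affine hull of `F`. -/
def linSpace {V : Type*} [AddCommGroup V] [Module ℝ V] (F : Set V) : Submodule ℝ V :=
  (affineSpan ℝ F).direction

/-- `F` is a nonempty face of the polytope `P` (`P` itself included): the set of points of `P`
where some linear functional attains its maximum over `P`. The dimension of `F` is the dimension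
of `lin(F)`. -/
def IsFace {V : Type*} [NormedAddCommGroup V] [NormedSpace ℝ V] (P F : Set V) : Prop :=
  F.Nonempty ∧ IsExposed ℝ P F

/-- The dual (reciprocal) lattice: the vectors having an integer inner product with every
element of `Λ`. -/
def dualLattice {V : Type*} [NormedAddCommGroup V] [InnerProductSpace ℝ V]
    (Λ : Submodule ℤ V) : Submodule ℤ V :=
  LinearMap.BilinForm.dualSubmodule (innerₗ V) Λ

theorem mem_dualLattice_iff {V : Type*} [NormedAddCommGroup V] [InnerProductSpace ℝ V]
    (Λ : Submodule ℤ V) (x : V) :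
    x ∈ dualLattice Λ ↔ ∀ y ∈ Λ, ∃ m : ℤ, (m : ℝ) = inner ℝ x y := by
  simp [dualLattice, LinearMap.BilinForm.mem_dualSubmodule, Submodule.mem_one]

/-- The exponential valuation `Φ_l(P) = ∫_P exp(2πi⟨l, x⟩) dx`. -/
def expValuation {V : Type*} [NormedAddCommGroup V] [InnerProductSpace ℝ V]
    [FiniteDimensional ℝ V] [MeasurableSpace V] [BorelSpace V] (l : V) (P : Set V) : ℂ :=
  ∫ x in P, Complex.exp (2 * (Real.pi : ℂ) * Complex.I * ((inner ℝ l x : ℝ) : ℂ))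

/-- `g` is a quasi-polynomial of degree at most `d` with period `t` and coefficient functions
`f 0, …, f d` (the values `f i` for `i > d` play no role). -/
def IsQuasiPolynomialWith (g : ℕ → ℂ) (d t : ℕ) (f : ℕ → ℕ → ℂ) : Prop :=
  (∀ n : ℕ, g n = ∑ i ∈ Finset.range (d + 1), f i n * (n : ℂ) ^ i) ∧
    ∀ i ≤ d, ∀ n : ℕ, f i (n + t) = f i n

end

open MeasureTheory

/-! Put `L = 2π⟨l, ·⟩`. Up to the phase `exp(i L(a))`, the valuation of `sP + a` is `s^d ∫_P exp(i s
L)`. The core claim, `pow_mul_setIntegral_mem_expSpan`, is that this function of `s` is a linear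
combination of terms `s^(dim T) exp(i s L(v))`, where `P = conv S` with `S` finite, `v ∈ S`, and `T`
is a face on which `L` is constant. Faces are handled as subsets of `S`.

The claim goes by induction on `d`. For `L = 0` the integral is a volume. Otherwise integrate first
along lines transverse to `ker L`: one factor `s` cancels and leaves the exponentials at the two
ends of each fibre (`exists_mul_setIntegral_eq`). The upper end is piecewise affine over the
projection of `P`, with pieces the projected upper faces (`exists_roofs`); the lower end is the
upper end for `-L`. What remains are integrals of the same kind in dimension `d - 1`, and the faces
that they contribute lift back to `S` with the same dimension (`IsRoof.exp_mul_mem_expSpan`).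

Now let `s = n + ε`. As `t v ∈ Λ` and `l ∈ Λ*`, `exp(i s L(v))` has period `t` in `n`, while `(n +
ε)^j` expands into powers `n^i` with `i ≤ j`. So `n^i` arises only from faces of dimension at least
`i` on which `L` is constant, and these contain faces of dimension exactly `i`
(`IsSubface.exists_finrank_eq`). Since coefficient functions are unique
(`IsQuasiPolynomialWith.unique`), this applies to any choice of them. -/

/-- `T` is the set of points of `S` where some linear functional attains its maximum over `S`. -/
def IsSubface {E : Type*} [AddCommGroup E] [Module ℝ E] (S T : Finset E) : Prop :=
  T ⊆ S ∧ T.Nonempty ∧ ∃ (f : E →ₗ[ℝ] ℝ) (b : ℝ), (∀ v ∈ S, f v ≤ b) ∧ ∀ v ∈ S, f v = b ↔ v ∈ T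

/-! ### Faces of a finite point set and their dimensions. -/

section Subface

variable {E : Type*} [AddCommGroup E] [Module ℝ E]

theorem IsSubface.refl {S : Finset E} (hS : S.Nonempty) : IsSubface S S :=
  ⟨subset_rfl, hS, 0, 0, by simp, by simp⟩

/-- A large multiple of the functional cutting out `T` plus the one cutting out `U` cuts out `U`
from `S`. -/
theorem IsSubface.trans {S T U : Finset E} (hST : IsSubface S T) (hTU : IsSubface T U) :
    IsSubface S U := by
  obtain ⟨hTS, -, f, b, hf, hfT⟩ := hST
  obtain ⟨hUT, hU, g, c, hg, hgU⟩ := hTU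
  -- Off `T` the slack `b - f v` is strictly positive, so a large `N` outweighs `g`; one `N` serves
  -- all of the finite set `S`.
  have key : ∃ N : ℝ, ∀ v ∈ S, v ∉ T → N * (f v - b) + (g v - c) < 0 := by
    have h1 : ∀ v ∈ S, ∃ N : ℝ, ∀ M : ℝ, N ≤ M → v ∉ T → M * (f v - b) + (g v - c) < 0 := by
      intro v hv
      by_cases hvT : v ∈ T
      · exact ⟨0, fun M _ h => absurd hvT h⟩
      · have hlt : f v - b < 0 := by
          have := lt_of_le_of_ne (hf v hv) (fun h => hvT ((hfT v hv).1 h))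
          linarith
        refine ⟨(|g v - c| + 1) / (b - f v), fun M hM _ => ?_⟩
        rw [div_le_iff₀ (by linarith)] at hM
        nlinarith [le_abs_self (g v - c)]
    choose! N hN using h1
    obtain ⟨M, hM⟩ := (S.image N).bddAbove
    refine ⟨M, fun v hv hvT => hN v hv M (hM ?_) hvT⟩
    exact Finset.mem_coe.2 (Finset.mem_image_of_mem _ hv)
  obtain ⟨N, hN⟩ := key
  refine ⟨hUT.trans hTS, hU, N • f + g, N * b + c, fun v hv => ?_, fun v hv => ?_⟩
  · by_cases hvT : v ∈ T
    · have := (hfT v hv).2 hvT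
      simp only [LinearMap.add_apply, LinearMap.smul_apply, smul_eq_mul, this]
      linarith [hg v hvT]
    · have := hN v hv hvT
      simp only [LinearMap.add_apply, LinearMap.smul_apply, smul_eq_mul]
      linarith
  · by_cases hvT : v ∈ T
    · have := (hfT v hv).2 hvT
      simp only [LinearMap.add_apply, LinearMap.smul_apply, smul_eq_mul, this]
      rw [← hgU v hvT]
      constructor <;> intro h <;> linarith
    · have := hN v hv hvT
      simp only [LinearMap.add_apply, LinearMap.smul_apply, smul_eq_mul]
      refine ⟨fun h => by linarith, fun h => absurd (hUT h) hvT⟩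

theorem convexHull_le_of_forall_le {S : Set E} {f : E →ₗ[ℝ] ℝ} {b : ℝ} (hf : ∀ v ∈ S, f v ≤ b)
    {x : E} (hx : x ∈ convexHull ℝ S) : f x ≤ b :=
  convexHull_min (t := {x | f x ≤ b}) hf (convex_halfSpace_le f.isLinear b) hx

theorem convexHull_eq_of_forall_eq {S : Set E} {f : E →ₗ[ℝ] ℝ} {b : ℝ} (hf : ∀ v ∈ S, f v = b)
    {x : E} (hx : x ∈ convexHull ℝ S) : f x = b :=
  convexHull_min (t := {x | f x = b}) hf (convex_hyperplane f.isLinear b) hx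

/-- In a convex combination attaining the bound, the nonnegative terms `w v * (b - f v)` sum to
zero, so no weight falls outside `T`. -/
theorem mem_convexHull_of_eq_max {S T : Finset E} {f : E →ₗ[ℝ] ℝ} {b : ℝ}
    (hf : ∀ v ∈ S, f v ≤ b) (hT : ∀ v ∈ S, f v = b → v ∈ T) {x : E}
    (hx : x ∈ convexHull ℝ (S : Set E)) (hxb : f x = b) : x ∈ convexHull ℝ (T : Set E) := by
  classical
  obtain ⟨w, hw0, hw1, rfl⟩ := Finset.mem_convexHull'.1 hx
  have h0 : ∀ v ∈ S, w v * (b - f v) = 0 := by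
    refine (Finset.sum_eq_zero_iff_of_nonneg
      (fun v hv => mul_nonneg (hw0 v hv) (sub_nonneg.2 (hf v hv)))).1 ?_
    simp only [mul_sub, Finset.sum_sub_distrib, ← Finset.sum_mul, hw1]
    rw [map_sum] at hxb
    simp only [map_smul, smul_eq_mul] at hxb
    rw [hxb]; ring
  have h1 : ∀ v ∈ S, v ∉ T → w v = 0 := by
    intro v hv hvT
    rcases mul_eq_zero.1 (h0 v hv) with h | h
    · exact h
    · exact absurd (hT v hv (by linarith)) hvT
  have h2 : ∀ v ∈ S, v ∉ S.filter (· ∈ T) → w v = 0 := by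
    intro v hv hn
    exact h1 v hv (fun h => hn (Finset.mem_filter.2 ⟨hv, h⟩))
  have hsub : ((S.filter (· ∈ T) : Finset E) : Set E) ⊆ T := fun v hv => (Finset.mem_filter.1 hv).2
  refine convexHull_mono hsub (Finset.mem_convexHull'.2 ⟨w, fun v hv => ?_, ?_, ?_⟩)
  · exact hw0 v (Finset.mem_filter.1 hv).1
  · rw [← hw1]
    exact Finset.sum_subset (Finset.filter_subset _ _) fun v hv hn => h2 v hv hn
  · exact Finset.sum_subset (Finset.filter_subset _ _) fun v hv hn => by simp [h2 v hv hn]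

theorem linSpace_convexHull (S : Set E) : linSpace (convexHull ℝ S) = vectorSpan ℝ S := by
  rw [linSpace, affineSpan_convexHull, direction_affineSpan]

theorem vectorSpan_le_ker_iff {S : Set E} {f : E →ₗ[ℝ] ℝ} {v₀ : E} (hv₀ : v₀ ∈ S) :
    vectorSpan ℝ S ≤ LinearMap.ker f ↔ ∀ v ∈ S, f v = f v₀ := by
  rw [vectorSpan_eq_span_vsub_set_right ℝ hv₀, Submodule.span_le]
  simp only [vsub_eq_sub, Set.image_subset_iff]
  refine forall₂_congr fun v _ => ?_
  simp [sub_eq_zero]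

/-- Tilting the functional cutting out `T` until it touches a further point. -/
theorem IsSubface.exists_finrank_lt [FiniteDimensional ℝ E] {S T : Finset E} (hT : IsSubface S T)
    (hdim : Module.finrank ℝ (vectorSpan ℝ (T : Set E)) + 1 <
      Module.finrank ℝ (vectorSpan ℝ (S : Set E))) :
    ∃ U, IsSubface S U ∧ U ≠ S ∧ Module.finrank ℝ (vectorSpan ℝ (T : Set E)) <
      Module.finrank ℝ (vectorSpan ℝ (U : Set E)) := by
  classical
  obtain ⟨hTS, ⟨v₀, hv₀⟩, f, b, hf, hfT⟩ := hT
  have hne : T ≠ S := by rintro rfl; omega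
  obtain ⟨w, hwS, hwT⟩ : ∃ w ∈ S, w ∉ T := by
    by_contra! h
    exact hne (Finset.Subset.antisymm hTS h)
  have hf₀ : f v₀ = b := (hfT v₀ (hTS hv₀)).2 hv₀
  -- The tilting functional `g` will vanish on `W`: vanishing along `T` keeps `T` in the tilted
  -- face, and vanishing at `w - v₀` keeps `w` out of it, so that face is proper.
  set W := vectorSpan ℝ (T : Set E) ⊔ Submodule.span ℝ {w - v₀} with hW
  have hWfin : Module.finrank ℝ W < Module.finrank ℝ (vectorSpan ℝ (S : Set E)) := by
    refine lt_of_le_of_lt ?_ hdim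
    refine (Submodule.finrank_add_le_finrank_add_finrank _ _).trans ?_
    gcongr
    exact (finrank_span_le_card _).trans (by simp)
  have hnle : ¬ vectorSpan ℝ (S : Set E) ≤ W := fun h =>
    absurd (Submodule.finrank_mono h) (by omega)
  obtain ⟨x, hxS, hxW⟩ := SetLike.not_le_iff_exists.1 hnle
  obtain ⟨g₀, hg₀x, hg₀W⟩ := Submodule.exists_le_ker_of_notMem hxW
  have hexists : ∃ g : E →ₗ[ℝ] ℝ, W ≤ LinearMap.ker g ∧ ∃ v ∈ S, 0 < g (v - v₀) := by
    have : ∃ v ∈ S, g₀ (v - v₀) ≠ 0 := by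
      by_contra! h
      refine hg₀x ?_
      have : vectorSpan ℝ (S : Set E) ≤ LinearMap.ker g₀ := by
        rw [vectorSpan_le_ker_iff (Finset.mem_coe.2 (hTS hv₀))]
        intro v hv
        have := h v hv
        rwa [map_sub, sub_eq_zero] at this
      exact this hxS
    obtain ⟨v, hv, hgv⟩ := this
    rcases lt_or_gt_of_ne hgv with h | h
    · refine ⟨-g₀, fun y hy => ?_, v, hv, by simpa using h⟩
      have : g₀ y = 0 := hg₀W hy
      simp [this]
    · exact ⟨g₀, hg₀W, v, hv, h⟩
  obtain ⟨g, hgW, v₁, hv₁, hgv₁⟩ := hexists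
  have hgT : ∀ v ∈ T, g (v - v₀) = 0 := fun v hv =>
    hgW (Submodule.mem_sup_left (vsub_mem_vectorSpan ℝ (Finset.mem_coe.2 hv) (Finset.mem_coe.2 hv₀)))
  have hgw : g (w - v₀) = 0 := hgW (Submodule.mem_sup_right (Submodule.mem_span_singleton_self _))
  obtain ⟨u, hu, humin⟩ := Finset.exists_min_image (S.filter fun v => 0 < g (v - v₀))
    (fun v => (b - f v) / g (v - v₀)) ⟨v₁, Finset.mem_filter.2 ⟨hv₁, hgv₁⟩⟩
  rw [Finset.mem_filter] at hu
  obtain ⟨huS, hgu⟩ := hu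
  -- The largest tilt for which `f + τ • g` is still maximal on `T`; at this value `u` joins the
  -- face.
  set τ := (b - f u) / g (u - v₀) with hτ
  have hτ0 : 0 ≤ τ := div_nonneg (sub_nonneg.2 (hf u huS)) hgu.le
  have happ : ∀ v, (f + τ • g) v = f v + τ * g (v - v₀) + τ * g v₀ := by
    intro v; simp; ring
  set h := f + τ • g
  set c := b + τ * g v₀
  have hle : ∀ v ∈ S, h v ≤ c := by
    intro v hv
    rw [happ]
    have : τ * g (v - v₀) ≤ b - f v := by
      by_cases hpos : 0 < g (v - v₀)
      · have := humin v (Finset.mem_filter.2 ⟨hv, hpos⟩)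
        rwa [le_div_iff₀ hpos] at this
      · nlinarith [hf v hv]
    simp only [c]; linarith
  have hwne : h w ≠ c := by
    rw [happ, hgw]
    have := fun hh => hwT ((hfT w hwS).1 hh)
    intro hh
    apply this
    simp only [c] at hh; linarith
  have huc : h u = c := by
    rw [happ, hτ, div_mul_cancel₀ _ hgu.ne']
    simp only [c]; ring
  have hTc : ∀ v ∈ T, h v = c := by
    intro v hv
    rw [happ, hgT v hv, (hfT v (hTS hv)).2 hv]
    simp only [c]; ring
  refine ⟨S.filter fun v => h v = c, ⟨Finset.filter_subset _ _, ⟨u, Finset.mem_filter.2 ⟨huS, huc⟩⟩,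
    h, c, hle, fun v hv => by simp [hv]⟩, ?_, ?_⟩
  · intro heq
    rw [← heq] at hwS
    exact hwne (Finset.mem_filter.1 hwS).2
  · have hsub : (T : Set E) ⊆ (S.filter fun v => h v = c : Finset E) := fun v hv =>
      Finset.mem_coe.2 (Finset.mem_filter.2 ⟨hTS hv, hTc v hv⟩)
    refine Submodule.finrank_lt_finrank_of_lt (lt_of_le_of_ne (vectorSpan_mono ℝ hsub) ?_)
    intro heq
    have hmem : u - v₀ ∈ vectorSpan ℝ (T : Set E) := by
      rw [heq]
      exact vsub_mem_vectorSpan ℝ (Finset.mem_coe.2 (Finset.mem_filter.2 ⟨huS, huc⟩)) (hsub hv₀)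
    have : g (u - v₀) = 0 := hgW (Submodule.mem_sup_left hmem)
    linarith

/-- If the spans agreed, the functional cutting out `T` would be constant on all of `S`. -/
theorem IsSubface.finrank_lt [FiniteDimensional ℝ E] {S T : Finset E} (hT : IsSubface S T)
    (hne : T ≠ S) : Module.finrank ℝ (vectorSpan ℝ (T : Set E)) <
      Module.finrank ℝ (vectorSpan ℝ (S : Set E)) := by
  obtain ⟨hTS, ⟨v₀, hv₀⟩, f, b, hf, hfT⟩ := hT
  refine Submodule.finrank_lt_finrank_of_lt
    (lt_of_le_of_ne (vectorSpan_mono ℝ (Finset.coe_subset.2 hTS)) fun heq => hne ?_)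
  have h1 : vectorSpan ℝ (T : Set E) ≤ LinearMap.ker f := by
    rw [vectorSpan_le_ker_iff (Finset.mem_coe.2 hv₀)]
    intro v hv
    rw [(hfT v (hTS hv)).2 hv, (hfT v₀ (hTS hv₀)).2 hv₀]
  rw [heq, vectorSpan_le_ker_iff (Finset.mem_coe.2 (hTS hv₀))] at h1
  refine Finset.Subset.antisymm hTS fun v hv => (hfT v hv).1 ?_
  rw [h1 v hv, (hfT v₀ (hTS hv₀)).2 hv₀]

/-- A proper face of maximal dimension is a facet, since otherwise tilting would enlarge it. -/
theorem exists_isSubface_finrank_pred [FiniteDimensional ℝ E] {S : Finset E} {j : ℕ}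
    (hj : Module.finrank ℝ (vectorSpan ℝ (S : Set E)) = j + 1) :
    ∃ T, IsSubface S T ∧ Module.finrank ℝ (vectorSpan ℝ (T : Set E)) = j := by
  classical
  have hne : (S.powerset.filter fun T => IsSubface S T ∧ T ≠ S).Nonempty := by
    have hpos : vectorSpan ℝ (S : Set E) ≠ ⊥ := by
      intro h; rw [h, finrank_bot] at hj; omega
    obtain ⟨v₀, hv₀⟩ : S.Nonempty := by
      rw [Finset.nonempty_iff_ne_empty]; rintro rfl; simp at hpos
    obtain ⟨w, hw, hwv⟩ : ∃ w ∈ S, w ≠ v₀ := by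
      by_contra! h
      have : S = {v₀} := Finset.eq_singleton_iff_unique_mem.2 ⟨hv₀, h⟩
      simp [this] at hpos
    obtain ⟨f, hf⟩ : ∃ f : E →ₗ[ℝ] ℝ, f (w - v₀) ≠ 0 := by
      by_contra! h
      exact hwv (sub_eq_zero.1 ((Module.forall_dual_apply_eq_zero_iff ℝ _).1 h))
    obtain ⟨u, hu, humax⟩ := Finset.exists_max_image S f ⟨v₀, hv₀⟩
    refine ⟨S.filter fun v => f v = f u, Finset.mem_filter.2
      ⟨Finset.mem_powerset.2 (Finset.filter_subset _ _), ⟨Finset.filter_subset _ _,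
        ⟨u, Finset.mem_filter.2 ⟨hu, rfl⟩⟩, f, f u, humax, fun v hv => by simp [hv]⟩, fun heq => ?_⟩⟩
    rw [Finset.filter_eq_self] at heq
    apply hf
    rw [map_sub, heq w hw, heq v₀ hv₀, sub_self]
  obtain ⟨T, hT, hmax⟩ := Finset.exists_max_image _
    (fun T : Finset E => Module.finrank ℝ (vectorSpan ℝ (T : Set E))) hne
  obtain ⟨-, hT, hTS⟩ := Finset.mem_filter.1 hT
  refine ⟨T, hT, ?_⟩
  have hlt := hT.finrank_lt hTS
  by_contra hcon
  obtain ⟨U, hU, hUS, hTU⟩ := hT.exists_finrank_lt (by omega)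
  have := hmax U (Finset.mem_filter.2 ⟨Finset.mem_powerset.2 hU.1, hU, hUS⟩)
  omega

theorem IsSubface.exists_finrank_eq [FiniteDimensional ℝ E] {S T : Finset E} (hT : IsSubface S T)
    {i : ℕ} (hi : i ≤ Module.finrank ℝ (vectorSpan ℝ (T : Set E))) :
    ∃ U, IsSubface S U ∧ U ⊆ T ∧ Module.finrank ℝ (vectorSpan ℝ (U : Set E)) = i := by
  induction hi using Nat.decreasingInduction with
  | self => exact ⟨T, hT, subset_rfl, rfl⟩
  | of_succ k _ ih =>
    obtain ⟨U, hU, hUT, hUk⟩ := ih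
    obtain ⟨R, hR, hRk⟩ := exists_isSubface_finrank_pred hUk
    exact ⟨R, hU.trans hR, hR.1.trans hUT, hRk⟩

end Subface

theorem IsSubface.isFace {E : Type*} [NormedAddCommGroup E] [NormedSpace ℝ E]
    [FiniteDimensional ℝ E] {S T : Finset E} (hT : IsSubface S T) :
    IsFace (convexHull ℝ (S : Set E)) (convexHull ℝ (T : Set E)) := by
  obtain ⟨hTS, ⟨v₀, hv₀⟩, f, b, hf, hfT⟩ := hT
  have hv₀' := subset_convexHull ℝ (T : Set E) (Finset.mem_coe.2 hv₀)
  have hsub := convexHull_mono (𝕜 := ℝ) (Finset.coe_subset.2 hTS)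
  refine ⟨⟨v₀, hv₀'⟩, fun _ => ⟨LinearMap.toContinuousLinearMap f, ?_⟩⟩
  have hTb : ∀ x ∈ convexHull ℝ (T : Set E), f x = b := fun x hx =>
    convexHull_eq_of_forall_eq (fun v hv => (hfT v (hTS hv)).2 hv) hx
  ext x
  simp only [Set.mem_ofPred_eq, LinearMap.coe_toContinuousLinearMap']
  constructor
  · intro hx
    exact ⟨hsub hx, fun y hy => (convexHull_le_of_forall_le hf hy).trans (hTb x hx).ge⟩
  · rintro ⟨hx, hmax⟩
    refine mem_convexHull_of_eq_max hf (fun v hv => (hfT v hv).1) hx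
      (le_antisymm (convexHull_le_of_forall_le hf hx) ?_)
    rw [← hTb v₀ hv₀']
    exact hmax v₀ (hsub hv₀')

/-! ### The upper boundary of a polytope over its projection. -/

/-- The affine function `m + c` lies above all points `(l v, π v)`, `v ∈ S`, and passes exactly
through those with `v ∈ T`. -/
structure IsRoof {E K : Type*} [AddCommGroup E] [Module ℝ E] [AddCommGroup K] [Module ℝ K]
    (S T : Finset E) (l : E →ₗ[ℝ] ℝ) (π : E →ₗ[ℝ] K) (m : K →ₗ[ℝ] ℝ) (c : ℝ) : Prop where
  subset : T ⊆ S
  nonempty : T.Nonempty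
  le : ∀ v ∈ S, l v ≤ m (π v) + c
  eq_iff : ∀ v ∈ S, l v = m (π v) + c ↔ v ∈ T

section Roof

variable {E K : Type*} [NormedAddCommGroup E] [NormedSpace ℝ E] [FiniteDimensional ℝ E]
  [NormedAddCommGroup K] [NormedSpace ℝ K] [FiniteDimensional ℝ K]

theorem LinearMap.eq_zero_of_eventually_le {g : K →ₗ[ℝ] ℝ} {y : K}
    (h : ∀ᶠ z in nhds y, g z ≤ g y) : g = 0 := by
  have h1 : IsLocalMax (LinearMap.toContinuousLinearMap g) y := h
  have h2 := h1.hasFDerivAt_eq_zero (LinearMap.toContinuousLinearMap g).hasFDerivAt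
  simpa using h2

/-- A supporting hyperplane at `p` of the region `D` on or below the upper boundary is not vertical,
because `π p` is an interior point of the projection. Hence it is the graph of an affine function
over `K`. -/
theorem exists_isRoof {l : E →ₗ[ℝ] ℝ} {π : E →ₗ[ℝ] K} (hbij : Function.Bijective (l.prod π))
    {S : Finset E} {p : E} (hp : p ∈ convexHull ℝ (S : Set E))
    (hint : π p ∈ interior (π '' convexHull ℝ (S : Set E)))
    (hmax : ∀ x ∈ convexHull ℝ (S : Set E), π x = π p → l x ≤ l p) :
    ∃ T m c, IsRoof S T l π m c ∧ p ∈ convexHull ℝ (T : Set E) := by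
  classical
  obtain ⟨e, he⟩ := hbij.2 (1, 0)
  have hle : l e = 1 := congrArg Prod.fst he
  have hπe : π e = 0 := congrArg Prod.snd he
  have hdecomp : ∀ x, π x = 0 → x = l x • e := by
    intro x hx
    apply hbij.1
    simp [hx, hle, hπe]
  set P := convexHull ℝ (S : Set E) with hP
  have hPconv : Convex ℝ P := convex_convexHull ℝ _
  set D : Set E := {x | ∃ x' ∈ P, π x' = π x ∧ l x ≤ l x'} with hD
  have hDconv : Convex ℝ D := by
    rintro x ⟨x', hx', h1, h2⟩ y ⟨y', hy', h3, h4⟩ a b ha hb hab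
    refine ⟨a • x' + b • y', hPconv hx' hy' ha hb hab, by simp [h1, h3], ?_⟩
    simp only [map_add, map_smul, smul_eq_mul]
    gcongr
  have hpD : p ∈ D := ⟨p, hp, rfl, le_rfl⟩
  have hpeD : p - e ∈ D := ⟨p, hp, by simp [hπe], by simp [hle]⟩
  have hpint : p ∉ interior D := by
    intro h
    have hcont : Filter.Tendsto (fun δ : ℝ => p + δ • e) (nhds 0) (nhds p) := by
      have : Continuous fun δ : ℝ => p + δ • e := by fun_prop
      simpa using this.tendsto 0
    have h1 := hcont.eventually (mem_interior_iff_mem_nhds.1 h)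
    obtain ⟨δ, hδ, hδ0⟩ := ((h1.filter_mono nhdsWithin_le_nhds).and
      (self_mem_nhdsWithin : Set.Ioi (0 : ℝ) ∈ nhdsWithin 0 (Set.Ioi 0))).exists
    obtain ⟨x', hx', h2, h3⟩ := hδ
    have h4 := hmax x' hx' (by simpa [hπe] using h2)
    simp only [map_add, map_smul, hle, smul_eq_mul, mul_one] at h3
    have : (0 : ℝ) < δ := hδ0
    linarith
  have hDint : (interior D).Nonempty := by
    rw [hDconv.interior_nonempty_iff_affineSpan_eq_top,
      ← AffineSubspace.direction_eq_top_iff_of_nonempty ⟨p, subset_affineSpan ℝ D hpD⟩,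
      direction_affineSpan]
    have heW : e ∈ vectorSpan ℝ D := by
      have := vsub_mem_vectorSpan ℝ hpD hpeD
      simpa using this
    have hPD : P ⊆ D := fun x hx => ⟨x, hx, rfl, le_rfl⟩
    have hmap : (vectorSpan ℝ D).map π = ⊤ := by
      rw [eq_top_iff]
      have h1 : vectorSpan ℝ (π '' P) = ⊤ := by
        have hc : Convex ℝ (π '' P) := hPconv.linear_image π
        have h2 := hc.interior_nonempty_iff_affineSpan_eq_top.1 ⟨_, hint⟩
        rw [← direction_affineSpan, h2, AffineSubspace.direction_top]
      rw [← h1]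
      have h3 := AffineMap.map_vectorSpan (π.toAffineMap) (s := P)
      simp only [LinearMap.toAffineMap_linear, LinearMap.coe_toAffineMap] at h3
      rw [← h3]
      exact Submodule.map_mono (vectorSpan_mono ℝ hPD)
    rw [eq_top_iff]
    intro x _
    obtain ⟨w, hw, hwx⟩ : π x ∈ (vectorSpan ℝ D).map π := by rw [hmap]; trivial
    have h1 := hdecomp (x - w) (by simp [hwx])
    rw [← sub_add_cancel x w, h1]
    exact Submodule.add_mem _ (Submodule.smul_mem _ _ heW) hw
  obtain ⟨f, hf0, hf⟩ := geometric_hahn_banach_of_nonempty_interior_point hDconv hpint hDint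
  set Ψ := LinearEquiv.ofBijective (l.prod π) hbij with hΨ
  set g : K →ₗ[ℝ] ℝ := f.toLinearMap ∘ₗ Ψ.symm.toLinearMap ∘ₗ LinearMap.inr ℝ ℝ K with hg
  have hfx : ∀ x, f x = l x * f e + g (π x) := by
    intro x
    have h1 : x = l x • e + Ψ.symm (0, π x) := by
      apply Ψ.injective
      rw [map_add, LinearEquiv.apply_symm_apply]
      simp [hΨ, hle, hπe]
    conv_lhs => rw [h1]
    simp [hg]
  have hfe0 : 0 ≤ f e := by
    have := hf _ hpeD
    rw [map_sub] at this
    linarith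
  -- If `f e = 0`, then `f` factors through `π` and is maximal at an interior point of the
  -- projection, so it vanishes.
  have hfe : 0 < f e := by
    refine lt_of_le_of_ne hfe0 fun h => hf0 ?_
    have hg0 : g = 0 := by
      apply LinearMap.eq_zero_of_eventually_le (y := π p)
      filter_upwards [mem_interior_iff_mem_nhds.1 hint] with z hz
      obtain ⟨x, hx, rfl⟩ := hz
      have := hf x ⟨x, hx, rfl, le_rfl⟩
      rw [hfx, hfx p, ← h] at this
      simpa using this
    ext x
    rw [hfx, ← h, hg0]; simp
  have hSD : ∀ v ∈ S, f v ≤ f p := fun v hv =>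
    hf v ⟨v, subset_convexHull ℝ _ (Finset.mem_coe.2 hv), rfl, le_rfl⟩
  have hiff : ∀ v, (-(f e)⁻¹ • g) (π v) + (l p + (f e)⁻¹ * g (π p)) - l v
      = (f e)⁻¹ * (f p - f v) := by
    intro v
    rw [hfx p, hfx v]
    simp only [LinearMap.smul_apply, smul_eq_mul]
    field_simp
    ring
  have hconv : p ∈ convexHull ℝ ((S.filter fun v => f v = f p : Finset E) : Set E) :=
    mem_convexHull_of_eq_max (f := f.toLinearMap) (b := f p) hSD
      (fun v hv h => Finset.mem_filter.2 ⟨hv, h⟩) hp rfl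
  refine ⟨S.filter fun v => f v = f p, -(f e)⁻¹ • g, l p + (f e)⁻¹ * g (π p),
    ⟨Finset.filter_subset _ _, ?_, fun v hv => ?_, fun v hv => ?_⟩, hconv⟩
  · rw [← Finset.coe_nonempty, ← convexHull_nonempty_iff (𝕜 := ℝ)]
    exact ⟨p, hconv⟩
  · rw [← sub_nonneg, hiff]
    exact mul_nonneg (inv_nonneg.2 hfe.le) (sub_nonneg.2 (hSD v hv))
  · rw [eq_comm, ← sub_eq_zero, hiff, Finset.mem_filter, mul_eq_zero, inv_eq_zero, sub_eq_zero]
    simp only [hfe.ne', false_or, hv, true_and]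
    exact eq_comm

omit [FiniteDimensional ℝ E] [FiniteDimensional ℝ K] in
-- The roof lies above `p` and is attained over `π p` by a point of `conv T`, which cannot be higher
-- than `p`.
theorem IsRoof.apply_eq {l : E →ₗ[ℝ] ℝ} {π : E →ₗ[ℝ] K} {S T : Finset E} {m : K →ₗ[ℝ] ℝ} {c : ℝ}
    (h : IsRoof S T l π m c) {p : E} (hp : p ∈ convexHull ℝ (S : Set E))
    (hmax : ∀ x ∈ convexHull ℝ (S : Set E), π x = π p → l x ≤ l p)
    (hy : π p ∈ convexHull ℝ (π '' (T : Set E))) : m (π p) + c = l p := by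
  rw [← LinearMap.image_convexHull] at hy
  obtain ⟨q, hq, hqp⟩ := hy
  have h1 : (l - m ∘ₗ π) q = c := convexHull_eq_of_forall_eq (fun v hv => by
    have := (h.eq_iff v (h.subset hv)).2 hv
    simp [this]) hq
  have h2 : (l - m ∘ₗ π) p ≤ c := convexHull_le_of_forall_le (fun v hv => by
    have := h.le v hv
    simp; linarith) hp
  have h3 := hmax q (convexHull_mono (Finset.coe_subset.2 h.subset) hq) hqp
  simp only [LinearMap.sub_apply, LinearMap.comp_apply, hqp] at h1 h2
  linarith

theorem ae_affine_ne [MeasurableSpace K] [BorelSpace K] (ν : Measure K) [ν.IsAddHaarMeasure]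
    {m m' : K →ₗ[ℝ] ℝ} {c c' : ℝ} (h : ¬ (m = m' ∧ c = c')) : ∀ᵐ y ∂ν, m y + c ≠ m' y + c' := by
  rw [ae_iff]
  simp only [ne_eq, not_not]
  rcases Set.eq_empty_or_nonempty {y | m y + c = m' y + c'} with hemp | ⟨y₀, hy₀⟩
  · rw [hemp, measure_empty]
  · have hy₀ : m y₀ + c = m' y₀ + c' := hy₀
    have hne : AffineSubspace.mk' y₀ (LinearMap.ker (m - m')) ≠ ⊤ := by
      intro htop
      have h1 : LinearMap.ker (m - m') = ⊤ := by
        rw [← AffineSubspace.direction_mk' y₀ (LinearMap.ker (m - m')), htop,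
          AffineSubspace.direction_top]
      have h2 : m = m' := sub_eq_zero.1 (LinearMap.ker_eq_top.1 h1)
      subst h2
      exact h ⟨rfl, by linarith⟩
    refine measure_mono_null (fun y hy => ?_) (Measure.addHaar_affineSubspace ν _ hne)
    have hy : m y + c = m' y + c' := hy
    rw [SetLike.mem_coe, AffineSubspace.mem_mk']
    simp only [vsub_eq_sub, LinearMap.mem_ker, LinearMap.sub_apply, map_sub]
    linarith

/-- The upper boundary of the polytope `conv S` over `π (conv S)` is piecewise affine. -/
theorem exists_roofs {l : E →ₗ[ℝ] ℝ} {π : E →ₗ[ℝ] K} (hbij : Function.Bijective (l.prod π))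
    (S : Finset E) [MeasurableSpace K] [BorelSpace K] (ν : Measure K) [ν.IsAddHaarMeasure] :
    ∃ (U : Finset (Finset E)) (m : Finset E → K →ₗ[ℝ] ℝ) (c : Finset E → ℝ),
      (∀ T ∈ U, IsRoof S T l π (m T) (c T)) ∧
      ∀ᵐ y ∂ν, ∀ p ∈ convexHull ℝ (S : Set E), π p = y →
        (∀ x ∈ convexHull ℝ (S : Set E), π x = y → l x ≤ l p) → ∀ g : ℝ → ℂ,
          ∑ T ∈ U, (convexHull ℝ (π '' (T : Set E))).indicator (fun z => g (m T z + c T)) y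
            = g (l p) := by
  classical
  set U := S.powerset.filter fun T => ∃ (m : K →ₗ[ℝ] ℝ) (c : ℝ), IsRoof S T l π m c with hU
  have hex : ∀ T ∈ U, ∃ (m : K →ₗ[ℝ] ℝ) (c : ℝ), IsRoof S T l π m c := fun T hT =>
    (Finset.mem_filter.1 hT).2
  choose! m c hmc using hex
  refine ⟨U, m, c, hmc, ?_⟩
  have h1 : ∀ᵐ y ∂ν, y ∉ frontier (π '' convexHull ℝ (S : Set E)) :=
    measure_eq_zero_iff_ae_notMem.1 (((convex_convexHull ℝ _).linear_image π).addHaar_frontier ν)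
  -- A roof determines its contact set, so distinct members of `U` carry distinct affine functions,
  -- which agree only on a null set. Hence almost every point is covered by at most one piece.
  have h2 : ∀ᵐ y ∂ν, ∀ T ∈ U, ∀ T' ∈ U, T ≠ T' → m T y + c T ≠ m T' y + c T' := by
    rw [Filter.eventually_all_finset]
    intro T hT
    rw [Filter.eventually_all_finset]
    intro T' hT'
    by_cases hTT : T = T'
    · simp [hTT]
    · refine (ae_affine_ne ν ?_).mono fun y hy _ => hy
      rintro ⟨hm, hc⟩
      apply hTT
      ext v
      constructor
      · intro hv
        have hvS := (hmc T hT).subset hv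
        rw [← (hmc T' hT').eq_iff v hvS, ← hm, ← hc, (hmc T hT).eq_iff v hvS]
        exact hv
      · intro hv
        have hvS := (hmc T' hT').subset hv
        rw [← (hmc T hT).eq_iff v hvS, hm, hc, (hmc T' hT').eq_iff v hvS]
        exact hv
  filter_upwards [h1, h2] with y hy1 hy2 p hp hpy hmax g
  subst hpy
  have hint : π p ∈ interior (π '' convexHull ℝ (S : Set E)) := by
    by_contra hcon
    exact hy1 ⟨subset_closure ⟨p, hp, rfl⟩, hcon⟩
  obtain ⟨T, m', c', hroof, hpT⟩ := exists_isRoof hbij hp hint hmax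
  have hTU : T ∈ U :=
    Finset.mem_filter.2 ⟨Finset.mem_powerset.2 hroof.subset, m', c', hroof⟩
  have hyT : π p ∈ convexHull ℝ (π '' (T : Set E)) := by
    rw [← LinearMap.image_convexHull]
    exact ⟨p, hpT, rfl⟩
  rw [Finset.sum_eq_single T]
  · rw [Set.indicator_of_mem hyT, (hmc T hTU).apply_eq hp hmax hyT]
  · intro T' hT' hne
    rw [Set.indicator_of_notMem]
    intro hyT'
    exact hy2 T' hT' T hTU hne
      (((hmc T' hT').apply_eq hp hmax hyT').trans ((hmc T hTU).apply_eq hp hmax hyT).symm)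
  · exact fun h => absurd hTU h

end Roof

/-! ### The space of admissible exponential terms. -/

/-- The span of the functions `s ↦ s ^ dim T * exp (i s l(v))`, where `v` is in `S` and `T` runs over
the faces of `S` on which `l` is constant. -/
def expSpan {E : Type*} [AddCommGroup E] [Module ℝ E] (S : Finset E) (l : E →ₗ[ℝ] ℝ) :
    Submodule ℂ (ℝ → ℂ) :=
  Submodule.span ℂ {g | ∃ (T : Finset E) (v : E), IsSubface S T ∧
    vectorSpan ℝ (T : Set E) ≤ LinearMap.ker l ∧ v ∈ S ∧
    g = fun s : ℝ => (s : ℂ) ^ Module.finrank ℝ (vectorSpan ℝ (T : Set E)) *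
      Complex.exp (Complex.I * (s * l v : ℝ))}

section ExpSpan

variable {E K : Type*} [AddCommGroup E] [Module ℝ E] [AddCommGroup K] [Module ℝ K]

theorem IsRoof.isSubface {S T : Finset E} {l : E →ₗ[ℝ] ℝ} {π : E →ₗ[ℝ] K} {m : K →ₗ[ℝ] ℝ} {c : ℝ}
    (h : IsRoof S T l π m c) : IsSubface S T := by
  refine ⟨h.subset, h.nonempty, l - m ∘ₗ π, c, fun v hv => ?_, fun v hv => ?_⟩
  · have := h.le v hv
    simp only [LinearMap.sub_apply, LinearMap.comp_apply]; linarith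
  · rw [← h.eq_iff v hv]
    simp only [LinearMap.sub_apply, LinearMap.comp_apply]
    constructor <;> intro h <;> linarith

theorem IsSubface.filter_image [DecidableEq K] {T : Finset E} {T' : Finset K} {π : E →ₗ[ℝ] K}
    (h : IsSubface (T.image π) T') : IsSubface T (T.filter fun v => π v ∈ T') := by
  obtain ⟨hsub, ⟨v₀, hv₀⟩, f, b, hf, hfT⟩ := h
  obtain ⟨u, hu, hu'⟩ := Finset.mem_image.1 (hsub hv₀)
  refine ⟨Finset.filter_subset _ _, ⟨u, Finset.mem_filter.2 ⟨hu, by rwa [hu']⟩⟩, f ∘ₗ π, b,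
    fun v hv => hf _ (Finset.mem_image_of_mem _ hv), fun v hv => ?_⟩
  rw [LinearMap.comp_apply, hfT _ (Finset.mem_image_of_mem _ hv), Finset.mem_filter]
  simp [hv]

/-- On `T` one has `l = m ∘ π + c`, so the exponents match, and `l` is constant on the part `R` of
`T` over a face where `m` is constant. Since `π` is injective on `ker l`, `R` has the dimension of
its image. -/
theorem IsRoof.exp_mul_mem_expSpan [DecidableEq K] {S T : Finset E} {l : E →ₗ[ℝ] ℝ}
    {π : E →ₗ[ℝ] K} (hbij : Function.Bijective (l.prod π)) {m : K →ₗ[ℝ] ℝ} {c : ℝ}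
    (h : IsRoof S T l π m c) {g : ℝ → ℂ} (hg : g ∈ expSpan (T.image π) m) :
    (fun s : ℝ => Complex.exp (Complex.I * (s * c : ℝ)) * g s) ∈ expSpan S l := by
  have key : expSpan (T.image π) m ≤ (expSpan S l).comap
      (LinearMap.mulLeft ℂ (fun s : ℝ => Complex.exp (Complex.I * (s * c : ℝ)))) := by
    refine Submodule.span_le.2 ?_
    rintro _ ⟨T', v', hT', hker, hv', rfl⟩
    obtain ⟨v, hv, rfl⟩ := Finset.mem_image.1 hv'
    set R := T.filter fun v => π v ∈ T' with hR
    have hTR : IsSubface T R := hT'.filter_image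
    obtain ⟨hsub, ⟨u₀, hu₀⟩, -⟩ := hT'
    obtain ⟨u, hu, rfl⟩ := Finset.mem_image.1 (hsub hu₀)
    have huR : u ∈ R := Finset.mem_filter.2 ⟨hu, hu₀⟩
    have himg : π '' (R : Set E) = T' := by
      ext z
      constructor
      · rintro ⟨x, hx, rfl⟩
        exact (Finset.mem_filter.1 hx).2
      · intro hz
        obtain ⟨x, hx, rfl⟩ := Finset.mem_image.1 (hsub hz)
        exact ⟨x, Finset.mem_coe.2 (Finset.mem_filter.2 ⟨hx, hz⟩), rfl⟩
    have hlR : ∀ x ∈ T, l x = m (π x) + c := fun x hx => (h.eq_iff x (h.subset hx)).2 hx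
    have hkerR : vectorSpan ℝ (R : Set E) ≤ LinearMap.ker l := by
      rw [vectorSpan_le_ker_iff (Finset.mem_coe.2 huR)]
      rw [vectorSpan_le_ker_iff (Finset.mem_coe.2 hu₀)] at hker
      intro x hx
      obtain ⟨hxT, hxT'⟩ := Finset.mem_filter.1 (Finset.mem_coe.1 hx)
      rw [hlR x hxT, hlR u hu, hker _ hxT']
    have hmap : (vectorSpan ℝ (R : Set E)).map π = vectorSpan ℝ (T' : Set K) := by
      have h3 := AffineMap.map_vectorSpan (π.toAffineMap) (s := (R : Set E))
      simp only [LinearMap.toAffineMap_linear, LinearMap.coe_toAffineMap] at h3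
      rw [h3, himg]
    have hdim : Module.finrank ℝ (vectorSpan ℝ (R : Set E)) =
        Module.finrank ℝ (vectorSpan ℝ (T' : Set K)) := by
      rw [← hmap, ← LinearMap.range_domRestrict]
      refine (LinearMap.finrank_range_of_inj ((injective_iff_map_eq_zero _).2 ?_)).symm
      rintro ⟨x, hx⟩ hπx
      have hlx : l x = 0 := hkerR hx
      have hπx : π x = 0 := hπx
      exact Subtype.ext (hbij.1 (a₁ := x) (a₂ := 0) (by simp [hlx, hπx]))
    refine Submodule.subset_span ⟨R, v, h.isSubface.trans hTR, hkerR, h.subset hv, ?_⟩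
    funext s
    simp only [LinearMap.mulLeft_apply, Pi.mul_apply]
    rw [hdim, hlR v hv, mul_left_comm, ← Complex.exp_add]
    push_cast
    ring_nf
  exact key hg

theorem expSpan_neg_le (S : Finset E) (l : E →ₗ[ℝ] ℝ) {g : ℝ → ℂ} (hg : g ∈ expSpan S (-l)) :
    (fun s => g (-s)) ∈ expSpan S l := by
  have key : expSpan S (-l) ≤ (expSpan S l).comap (LinearMap.funLeft ℂ ℂ (fun s : ℝ => -s)) := by
    refine Submodule.span_le.2 ?_
    rintro _ ⟨T, v, hT, hker, hv, rfl⟩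
    have hker' : vectorSpan ℝ (T : Set E) ≤ LinearMap.ker l := fun x hx => by
      have := hker hx
      simpa using this
    have : LinearMap.funLeft ℂ ℂ (fun s : ℝ => -s)
        (fun s : ℝ => (s : ℂ) ^ Module.finrank ℝ (vectorSpan ℝ (T : Set E)) *
          Complex.exp (Complex.I * (s * (-l) v : ℝ))) =
        (-1 : ℂ) ^ Module.finrank ℝ (vectorSpan ℝ (T : Set E)) •
        (fun s : ℝ => (s : ℂ) ^ Module.finrank ℝ (vectorSpan ℝ (T : Set E)) *
          Complex.exp (Complex.I * (s * l v : ℝ))) := by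
      funext s
      simp only [LinearMap.funLeft_apply, Pi.smul_apply, smul_eq_mul, LinearMap.neg_apply]
      rw [← mul_assoc, ← mul_pow]
      push_cast
      ring_nf
    rw [SetLike.mem_coe, Submodule.mem_comap, this]
    exact Submodule.smul_mem _ _ (Submodule.subset_span ⟨T, v, hT, hker', hv, rfl⟩)
  exact key hg

end ExpSpan

/-! ### Integration along the fibres. -/

theorem mul_setIntegral_Icc_exp {a b : ℝ} (hab : a ≤ b) (s : ℝ) :
    (s : ℂ) * ∫ r in Set.Icc a b, Complex.exp (Complex.I * (s * r : ℝ)) =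
      -Complex.I * (Complex.exp (Complex.I * (s * b : ℝ)) -
        Complex.exp (Complex.I * (s * a : ℝ))) := by
  rcases eq_or_ne s 0 with rfl | hs
  · simp
  · have hc : Complex.I * s ≠ 0 := mul_ne_zero Complex.I_ne_zero (by exact_mod_cast hs)
    have hs' : (s : ℂ) ≠ 0 := by exact_mod_cast hs
    rw [integral_Icc_eq_integral_Ioc, ← intervalIntegral.integral_of_le hab]
    have := integral_exp_mul_complex (a := a) (b := b) hc
    push_cast
    simp only [← mul_assoc]
    rw [this]
    field_simp
    rw [Complex.I_sq]
    ring

section Fubini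

variable {E K : Type*} [NormedAddCommGroup E] [NormedSpace ℝ E] [FiniteDimensional ℝ E]
  [NormedAddCommGroup K] [NormedSpace ℝ K] [FiniteDimensional ℝ K]
  [MeasurableSpace E] [BorelSpace E] [MeasurableSpace K] [BorelSpace K]

omit [FiniteDimensional ℝ E] [MeasurableSpace E] [BorelSpace E] in
theorem isCompact_convexHull_finset (S : Finset E) : IsCompact (convexHull ℝ (S : Set E)) :=
  S.finite_toSet.isCompact_convexHull ℝ

omit [FiniteDimensional ℝ K] in
theorem integrableOn_exp_convexHull (ν : Measure K) [ν.IsAddHaarMeasure] (T : Finset K)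
    {g : K → ℝ} (hg : Continuous g) :
    IntegrableOn (fun z => Complex.exp (Complex.I * (g z : ℝ))) (convexHull ℝ (T : Set K)) ν :=
  ContinuousOn.integrableOn_compact (isCompact_convexHull_finset T) (by fun_prop)

theorem exists_setIntegral_eq_iterated (μ : Measure E) [μ.IsAddHaarMeasure] (ν : Measure K)
    [ν.IsAddHaarMeasure] {l : E →ₗ[ℝ] ℝ} {π : E →ₗ[ℝ] K}
    (hbij : Function.Bijective (l.prod π)) :
    ∃ k : ℂ, ∀ (S : Finset E) (s : ℝ),
      ∫ x in convexHull ℝ (S : Set E), Complex.exp (Complex.I * (s * l x : ℝ)) ∂μ =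
        k * ∫ y, (∫ r in {r : ℝ | (LinearEquiv.ofBijective (l.prod π) hbij).symm (r, y) ∈
          convexHull ℝ (S : Set E)}, Complex.exp (Complex.I * (s * r : ℝ))) ∂ν := by
  set Ψ := LinearEquiv.ofBijective (l.prod π) hbij with hΨ
  set Θ : (ℝ × K) ≃L[ℝ] E := Ψ.symm.toContinuousLinearEquiv with hΘ
  have hlΘ : ∀ z, l (Θ z) = z.1 := fun z => congrArg Prod.fst (Ψ.apply_symm_apply z)
  set μ' : Measure E := Measure.map Θ ((volume : Measure ℝ).prod ν) with hμ'
  have hemb : MeasurableEmbedding Θ := Θ.toHomeomorph.measurableEmbedding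
  -- Uniqueness of Haar measure gives a scaling constant that depends on neither `S` nor `s`.
  obtain ⟨κ, hμ⟩ : ∃ κ : NNReal, μ = κ • μ' := ⟨_, Measure.isAddLeftInvariant_eq_smul _ _⟩
  refine ⟨(κ : ℝ), fun S s => ?_⟩
  have hcomp := isCompact_convexHull_finset S
  have hmeas : MeasurableSet (Θ ⁻¹' convexHull ℝ (S : Set E)) :=
    Θ.continuous.measurable hcomp.measurableSet
  have hcompΘ : IsCompact (Θ ⁻¹' convexHull ℝ (S : Set E)) :=
    Θ.toHomeomorph.isCompact_preimage.2 hcomp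
  have hint : Integrable ((Θ ⁻¹' convexHull ℝ (S : Set E)).indicator
      fun z : ℝ × K => Complex.exp (Complex.I * (s * z.1 : ℝ))) (volume.prod ν) := by
    rw [integrable_indicator_iff hmeas]
    exact ContinuousOn.integrableOn_compact hcompΘ (by fun_prop)
  conv_lhs => rw [hμ]
  rw [Measure.restrict_smul, integral_smul_nnreal_measure, hμ', hemb.setIntegral_map]
  simp only [hlΘ]
  rw [← integral_indicator hmeas, integral_prod_symm _ hint, NNReal.smul_def, Complex.real_smul]
  congr 1
  refine integral_congr_ae (Filter.Eventually.of_forall fun y => ?_)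
  have hmeasy : MeasurableSet {r : ℝ | Ψ.symm (r, y) ∈ convexHull ℝ (S : Set E)} :=
    hmeas.preimage (measurable_id.prodMk measurable_const)
  simp only
  rw [← integral_indicator hmeasy]
  rfl

omit [MeasurableSpace E] [BorelSpace E] [MeasurableSpace K] [BorelSpace K] in
-- A fibre is a compact convex subset of a line; `p` and `q` are its ends.
theorem slice_eq_empty_or_Icc {l : E →ₗ[ℝ] ℝ} {π : E →ₗ[ℝ] K}
    (hbij : Function.Bijective (l.prod π)) (S : Finset E) (y : K) :
    (y ∉ π '' convexHull ℝ (S : Set E) ∧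
      {r : ℝ | (LinearEquiv.ofBijective (l.prod π) hbij).symm (r, y) ∈ convexHull ℝ (S : Set E)}
        = ∅) ∨
    ∃ p ∈ convexHull ℝ (S : Set E), ∃ q ∈ convexHull ℝ (S : Set E), π p = y ∧ π q = y ∧
      l q ≤ l p ∧ (∀ x ∈ convexHull ℝ (S : Set E), π x = y → l x ≤ l p) ∧
      (∀ x ∈ convexHull ℝ (S : Set E), π x = y → l q ≤ l x) ∧
      {r : ℝ | (LinearEquiv.ofBijective (l.prod π) hbij).symm (r, y) ∈ convexHull ℝ (S : Set E)}
        = Set.Icc (l q) (l p) := by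
  set Ψ := LinearEquiv.ofBijective (l.prod π) hbij with hΨ
  have hlΨ : ∀ z, l (Ψ.symm z) = z.1 := fun z => congrArg Prod.fst (Ψ.apply_symm_apply z)
  have hπΨ : ∀ z, π (Ψ.symm z) = z.2 := fun z => congrArg Prod.snd (Ψ.apply_symm_apply z)
  have hΨx : ∀ x, Ψ.symm (l x, π x) = x := fun x => Ψ.symm_apply_apply x
  set A := {r : ℝ | Ψ.symm (r, y) ∈ convexHull ℝ (S : Set E)} with hA
  have hxA : ∀ x ∈ convexHull ℝ (S : Set E), π x = y → l x ∈ A := by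
    rintro x hx rfl
    simpa [hA, hΨx] using hx
  rcases A.eq_empty_or_nonempty with hemp | hne
  · refine Or.inl ⟨?_, hemp⟩
    rintro ⟨x, hx, hxy⟩
    have := hxA x hx hxy
    rw [hemp] at this
    exact this
  · right
    have hcomp := isCompact_convexHull_finset S
    have hcont : Continuous fun r : ℝ => Ψ.symm (r, y) :=
      (LinearMap.continuous_of_finiteDimensional Ψ.symm.toLinearMap).comp (by fun_prop)
    have hAcomp : IsCompact A := by
      refine (hcomp.image (LinearMap.continuous_of_finiteDimensional l)).of_isClosed_subset
        (hcomp.isClosed.preimage hcont) fun r hr => ⟨_, hr, hlΨ _⟩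
    have hAconv : Convex ℝ A := by
      intro r hr r' hr' a b ha hb hab
      have := convex_convexHull ℝ (S : Set E) hr hr' ha hb hab
      rw [← map_smul, ← map_smul, ← map_add] at this
      simpa [hA, ← add_smul, hab] using this
    have hIcc := eq_Icc_of_connected_compact ⟨hne, hAconv.isPreconnected⟩ hAcomp
    have hp := hAcomp.sSup_mem hne
    have hq := hAcomp.sInf_mem hne
    refine ⟨Ψ.symm (sSup A, y), hp, Ψ.symm (sInf A, y), hq, hπΨ _, hπΨ _, ?_, ?_, ?_, ?_⟩
    · rw [hlΨ, hlΨ]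
      exact csInf_le hAcomp.bddBelow hp
    · intro x hx hxy
      rw [hlΨ]
      exact le_csSup hAcomp.bddAbove (hxA x hx hxy)
    · intro x hx hxy
      rw [hlΨ]
      exact csInf_le hAcomp.bddBelow (hxA x hx hxy)
    · rw [hlΨ, hlΨ]
      exact hIcc

omit [FiniteDimensional ℝ E] [FiniteDimensional ℝ K] [MeasurableSpace E] [BorelSpace E]
  [MeasurableSpace K] [BorelSpace K] in
theorem bijective_neg_prod {l : E →ₗ[ℝ] ℝ} {π : E →ₗ[ℝ] K}
    (hbij : Function.Bijective (l.prod π)) : Function.Bijective ((-l).prod π) := by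
  have : ((-l).prod π : E → ℝ × K) =
      (Equiv.prodCongr (Equiv.neg ℝ) (Equiv.refl K)) ∘ (l.prod π) := rfl
  rw [this]
  exact (Equiv.bijective _).comp hbij

omit [FiniteDimensional ℝ E] [FiniteDimensional ℝ K] [MeasurableSpace E] [BorelSpace E]
  [MeasurableSpace K] [BorelSpace K] in
theorem sum_indicator_eq_zero {l : E →ₗ[ℝ] ℝ} {π : E →ₗ[ℝ] K} {S : Finset E}
    {U : Finset (Finset E)} {m : Finset E → K →ₗ[ℝ] ℝ} {c : Finset E → ℝ}
    (hU : ∀ T ∈ U, IsRoof S T l π (m T) (c T)) {y : K}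
    (hy : y ∉ π '' convexHull ℝ (S : Set E)) (g : ℝ → ℂ) :
    ∑ T ∈ U, (convexHull ℝ (π '' (T : Set E))).indicator (fun z => g (m T z + c T)) y = 0 := by
  refine Finset.sum_eq_zero fun T hT => Set.indicator_of_notMem (fun h => hy ?_) _
  rw [← LinearMap.image_convexHull] at h
  exact Set.image_mono (convexHull_mono (Finset.coe_subset.2 (hU T hT).subset)) h

/-- Integrating along the fibres of `π` reduces the exponential integral over a polytope to such
integrals over the projections of its upper and lower faces. -/
theorem exists_mul_setIntegral_eq (μ : Measure E) [μ.IsAddHaarMeasure] (ν : Measure K)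
    [ν.IsAddHaarMeasure] {l : E →ₗ[ℝ] ℝ} {π : E →ₗ[ℝ] K}
    (hbij : Function.Bijective (l.prod π)) (S : Finset E) :
    ∃ (k : ℂ) (U U' : Finset (Finset E)) (m m' : Finset E → K →ₗ[ℝ] ℝ) (c c' : Finset E → ℝ),
      (∀ T ∈ U, IsRoof S T l π (m T) (c T)) ∧ (∀ T ∈ U', IsRoof S T (-l) π (m' T) (c' T)) ∧
      ∀ s : ℝ,
        s * ∫ x in convexHull ℝ (S : Set E), Complex.exp (Complex.I * (s * l x : ℝ)) ∂μ =
          k * (∑ T ∈ U, Complex.exp (Complex.I * (s * c T : ℝ)) *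
              ∫ z in convexHull ℝ (π '' (T : Set E)), Complex.exp (Complex.I * (s * m T z : ℝ)) ∂ν -
            ∑ T ∈ U', Complex.exp (Complex.I * (-s * c' T : ℝ)) *
              ∫ z in convexHull ℝ (π '' (T : Set E)),
                Complex.exp (Complex.I * (-s * m' T z : ℝ)) ∂ν) := by
  classical
  obtain ⟨k, hk⟩ := exists_setIntegral_eq_iterated μ ν hbij
  obtain ⟨U, m, c, hU, hae⟩ := exists_roofs hbij S ν
  obtain ⟨U', m', c', hU', hae'⟩ := exists_roofs (bijective_neg_prod hbij) S ν
  refine ⟨k * -Complex.I, U, U', m, m', c, c', hU, hU', fun s => ?_⟩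
  have hterm : ∀ (T : Finset E) (n : K →ₗ[ℝ] ℝ) (b σ : ℝ),
      Integrable ((convexHull ℝ (π '' (T : Set E))).indicator
        fun z => Complex.exp (Complex.I * (σ * (n z + b) : ℝ))) ν ∧
      ∫ z, (convexHull ℝ (π '' (T : Set E))).indicator
        (fun z => Complex.exp (Complex.I * (σ * (n z + b) : ℝ))) z ∂ν =
      Complex.exp (Complex.I * (σ * b : ℝ)) *
        ∫ z in convexHull ℝ (π '' (T : Set E)), Complex.exp (Complex.I * (σ * n z : ℝ)) ∂ν := by
    intro T n b σ
    have hn : Continuous n := LinearMap.continuous_of_finiteDimensional n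
    rw [← Finset.coe_image]
    have hmeas : MeasurableSet (convexHull ℝ ((T.image π : Finset K) : Set K)) :=
      (isCompact_convexHull_finset _).measurableSet
    refine ⟨(integrable_indicator_iff hmeas).2
      (integrableOn_exp_convexHull ν (T.image π) (g := fun z => σ * (n z + b)) (by fun_prop)), ?_⟩
    rw [integral_indicator hmeas, ← integral_const_mul]
    refine integral_congr_ae (Filter.Eventually.of_forall fun z => ?_)
    simp only [← Complex.exp_add]
    push_cast
    ring_nf
  have hsum : ∀ᵐ y ∂ν,
      (s : ℂ) * ∫ r in {r : ℝ | (LinearEquiv.ofBijective (l.prod π) hbij).symm (r, y) ∈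
          convexHull ℝ (S : Set E)}, Complex.exp (Complex.I * (s * r : ℝ)) =
        -Complex.I * (∑ T ∈ U, (convexHull ℝ (π '' (T : Set E))).indicator
            (fun z => Complex.exp (Complex.I * (s * (m T z + c T) : ℝ))) y -
          ∑ T ∈ U', (convexHull ℝ (π '' (T : Set E))).indicator
            (fun z => Complex.exp (Complex.I * (-s * (m' T z + c' T) : ℝ))) y) := by
    filter_upwards [hae, hae'] with y hy hy'
    rcases slice_eq_empty_or_Icc hbij S y with ⟨hyP, hemp⟩ | ⟨p, hp, q, hq, hpy, hqy, hqp, hmax, hmin, hIcc⟩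
    · rw [hemp, sum_indicator_eq_zero hU hyP (fun r => Complex.exp (Complex.I * (s * r : ℝ))),
        sum_indicator_eq_zero hU' hyP (fun r => Complex.exp (Complex.I * (-s * r : ℝ)))]
      simp
    · rw [hIcc, mul_setIntegral_Icc_exp hqp,
        hy p hp hpy hmax (fun r => Complex.exp (Complex.I * (s * r : ℝ))),
        hy' q hq hqy (fun x hx hxy => by simpa using hmin x hx hxy)
          (fun r => Complex.exp (Complex.I * (-s * r : ℝ)))]
      simp
  rw [hk S s, mul_left_comm, ← integral_const_mul, integral_congr_ae hsum, integral_const_mul,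
    mul_assoc, integral_sub (integrable_finsetSum _ fun T _ => (hterm T _ _ _).1)
      (integrable_finsetSum _ fun T _ => (hterm T _ _ _).1),
    integral_finsetSum _ fun T _ => (hterm T _ _ _).1,
    integral_finsetSum _ fun T _ => (hterm T _ _ _).1]
  simp only [(hterm _ _ _ _).2]

end Fubini

-- Induction on the dimension.

universe u

/-- The integral is the volume of `conv S`: zero if `S` lies in a proper affine subspace, and
otherwise `S` itself is a face of full dimension. -/
theorem pow_mul_setIntegral_mem_expSpan_zero {E : Type*} [NormedAddCommGroup E] [NormedSpace ℝ E]
    [FiniteDimensional ℝ E] [MeasurableSpace E] [BorelSpace E] (μ : Measure E)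
    [μ.IsAddHaarMeasure] (S : Finset E) :
    (fun s : ℝ => (s : ℂ) ^ Module.finrank ℝ E * ∫ x in convexHull ℝ (S : Set E),
      Complex.exp (Complex.I * (s * (0 : E →ₗ[ℝ] ℝ) x : ℝ)) ∂μ) ∈ expSpan S 0 := by
  by_cases hspan : affineSpan ℝ (S : Set E) = ⊤
  · obtain ⟨v, hv⟩ : S.Nonempty := by
      rw [Finset.nonempty_iff_ne_empty]
      rintro rfl
      simp at hspan
    have hdim : Module.finrank ℝ (vectorSpan ℝ (S : Set E)) = Module.finrank ℝ E := by
      rw [← direction_affineSpan, hspan, AffineSubspace.direction_top, finrank_top]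
    have : (fun s : ℝ => (s : ℂ) ^ Module.finrank ℝ E * ∫ x in convexHull ℝ (S : Set E),
        Complex.exp (Complex.I * (s * (0 : E →ₗ[ℝ] ℝ) x : ℝ)) ∂μ) =
        (μ.real (convexHull ℝ (S : Set E)) : ℂ) • fun s : ℝ =>
          (s : ℂ) ^ Module.finrank ℝ (vectorSpan ℝ (S : Set E)) *
            Complex.exp (Complex.I * (s * (0 : E →ₗ[ℝ] ℝ) v : ℝ)) := by
      funext s
      simp [hdim, mul_comm]
    rw [this]
    exact Submodule.smul_mem _ _ (Submodule.subset_span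
      ⟨S, v, IsSubface.refl ⟨v, hv⟩, by simp, hv, rfl⟩)
  · have hnull : μ (convexHull ℝ (S : Set E)) = 0 :=
      measure_mono_null (convexHull_subset_affineSpan _)
        (Measure.addHaar_affineSubspace μ _ hspan)
    simp only [setIntegral_measure_zero _ hnull, mul_zero]
    exact Submodule.zero_mem _

/-- The space `E` is quantified inside the induction because the step passes to `ker l`, which lies
in the same universe. -/
theorem pow_mul_setIntegral_mem_expSpan (d : ℕ) : ∀ {E : Type u} [NormedAddCommGroup E]
    [NormedSpace ℝ E] [FiniteDimensional ℝ E] [MeasurableSpace E] [BorelSpace E] (μ : Measure E)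
    [μ.IsAddHaarMeasure], Module.finrank ℝ E = d → ∀ (S : Finset E) (l : E →ₗ[ℝ] ℝ),
    (fun s : ℝ => (s : ℂ) ^ d * ∫ x in convexHull ℝ (S : Set E),
      Complex.exp (Complex.I * (s * l x : ℝ)) ∂μ) ∈ expSpan S l := by
  classical
  induction d with
  | zero =>
    intro E _ _ _ _ _ μ _ hd S l
    have hsub : Subsingleton E := Module.finrank_zero_iff.1 hd
    obtain rfl : l = 0 := by
      ext x
      rw [Subsingleton.elim x 0]; simp
    rw [← hd]
    exact pow_mul_setIntegral_mem_expSpan_zero μ S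
  | succ d ih =>
    intro E _ _ _ _ _ μ _ hd S l
    rcases eq_or_ne l 0 with rfl | hl
    · rw [← hd]
      exact pow_mul_setIntegral_mem_expSpan_zero μ S
    obtain ⟨e, he⟩ : ∃ e, l e = 1 := LinearMap.surjective hl 1
    -- The projection onto `ker l` along `e`, so that `(l, π)` are coordinates on `E`.
    let π : E →ₗ[ℝ] LinearMap.ker l := LinearMap.codRestrict _
      (LinearMap.id - l.smulRight e) (fun x => by simp [he])
    have hπx : ∀ x, (π x : E) = x - l x • e := fun _ => rfl
    have hbij : Function.Bijective (l.prod π) := by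
      constructor
      · rw [injective_iff_map_eq_zero]
        intro x hx
        have h1 : l x = 0 := congrArg Prod.fst hx
        have h2 : (π x : E) = 0 := congrArg Subtype.val (congrArg Prod.snd hx)
        rwa [hπx, h1, zero_smul, sub_zero] at h2
      · rintro ⟨r, y, hy⟩
        have hy' : l y = 0 := hy
        refine ⟨r • e + y, Prod.ext (by simp [he, hy']) (Subtype.ext ?_)⟩
        change ((π (r • e + y) : LinearMap.ker l) : E) = y
        simp [hπx, he, hy']
    have hK : Module.finrank ℝ (LinearMap.ker l) = d := by
      have h1 := LinearMap.finrank_range_add_finrank_ker l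
      rw [LinearMap.range_eq_top.2 (LinearMap.surjective hl), finrank_top, Module.finrank_self] at h1
      omega
    set ν : Measure (LinearMap.ker l) := Measure.addHaar
    obtain ⟨k, U, U', m, m', c, c', hU, hU', hs⟩ := exists_mul_setIntegral_eq μ ν hbij S
    have hup : ∀ T ∈ U, (fun s : ℝ => Complex.exp (Complex.I * (s * c T : ℝ)) * ((s : ℂ) ^ d *
        ∫ z in convexHull ℝ (π '' (T : Set E)), Complex.exp (Complex.I * (s * m T z : ℝ)) ∂ν)) ∈
        expSpan S l := by
      intro T hT
      have h1 := ih ν hK (T.image π) (m T)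
      rw [Finset.coe_image] at h1
      exact (hU T hT).exp_mul_mem_expSpan hbij h1
    have hdown : ∀ T ∈ U', (fun s : ℝ => Complex.exp (Complex.I * (-s * c' T : ℝ)) *
        (((-s : ℝ) : ℂ) ^ d * ∫ z in convexHull ℝ (π '' (T : Set E)),
          Complex.exp (Complex.I * (-s * m' T z : ℝ)) ∂ν)) ∈ expSpan S l := by
      intro T hT
      have h1 := ih ν hK (T.image π) (m' T)
      rw [Finset.coe_image] at h1
      exact expSpan_neg_le S l ((hU' T hT).exp_mul_mem_expSpan (bijective_neg_prod hbij) h1)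
    -- The lower faces use the induction hypothesis at `-s`; the factor `(-1)^d` turns `(-s)^d` back
    -- into `s^d`.
    have hfinal := Submodule.smul_mem _ k (Submodule.sub_mem _ (Submodule.sum_mem _ hup)
      (Submodule.smul_mem _ ((-1 : ℂ) ^ d) (Submodule.sum_mem _ hdown)))
    refine (congrArg (· ∈ expSpan S l) (funext fun s => ?_)).mpr hfinal
    rw [pow_succ, mul_assoc, hs s]
    simp only [Pi.smul_apply, Pi.sub_apply, Finset.sum_apply, smul_eq_mul]
    rw [mul_left_comm, mul_sub, Finset.mul_sum, Finset.mul_sum, Finset.mul_sum]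
    congr 2
    · exact Finset.sum_congr rfl fun T _ => by ring
    · refine Finset.sum_congr rfl fun T _ => ?_
      have : (s : ℂ) ^ d = (-1) ^ d * ((-s : ℝ) : ℂ) ^ d := by
        rw [← mul_pow]; push_cast; ring
      rw [this]; ring

/-! ### Quasi-polynomials and their coefficients. -/

section QuasiPolynomial

theorem IsQuasiPolynomialWith.add {g g' : ℕ → ℂ} {d t : ℕ} {f f' : ℕ → ℕ → ℂ}
    (h : IsQuasiPolynomialWith g d t f) (h' : IsQuasiPolynomialWith g' d t f') :
    IsQuasiPolynomialWith (g + g') d t (f + f') := by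
  refine ⟨fun n => ?_, fun i hi n => ?_⟩
  · simp only [Pi.add_apply, h.1 n, h'.1 n, add_mul, Finset.sum_add_distrib]
  · simp only [Pi.add_apply, h.2 i hi n, h'.2 i hi n]

theorem IsQuasiPolynomialWith.smul {g : ℕ → ℂ} {d t : ℕ} {f : ℕ → ℕ → ℂ}
    (h : IsQuasiPolynomialWith g d t f) (c : ℂ) :
    IsQuasiPolynomialWith (c • g) d t (c • f) := by
  refine ⟨fun n => ?_, fun i hi n => ?_⟩
  · simp only [Pi.smul_apply, h.1 n, smul_eq_mul, Finset.mul_sum, mul_assoc]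
  · simp only [Pi.smul_apply, h.2 i hi n]

theorem IsQuasiPolynomialWith.apply_add_mul {g : ℕ → ℂ} {d t : ℕ} {f : ℕ → ℕ → ℂ}
    (h : IsQuasiPolynomialWith g d t f) {i : ℕ} (hi : i ≤ d) (n k : ℕ) :
    f i (n + k * t) = f i n := by
  induction k with
  | zero => simp
  | succ k ih => rw [Nat.succ_mul, ← add_assoc, h.2 i hi, ih]

/-- The coefficient functions of a quasi-polynomial are determined by its values. -/
theorem IsQuasiPolynomialWith.unique {g : ℕ → ℂ} {d t : ℕ} (ht : 0 < t) {f f' : ℕ → ℕ → ℂ}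
    (h : IsQuasiPolynomialWith g d t f) (h' : IsQuasiPolynomialWith g d t f') {i : ℕ} (hi : i ≤ d)
    (n : ℕ) : f i n = f' i n := by
  -- With `n` fixed, the coefficients are constant along `n + k * t`, so `p` has infinitely many
  -- roots.
  set p : Polynomial ℂ :=
    ∑ j ∈ Finset.range (d + 1), Polynomial.monomial j (f j n - f' j n) with hp
  have hroot : ∀ k : ℕ, p.IsRoot ((n + k * t : ℕ) : ℂ) := by
    intro k
    have h1 : ∑ j ∈ Finset.range (d + 1), f j n * ((n + k * t : ℕ) : ℂ) ^ j =
        ∑ j ∈ Finset.range (d + 1), f' j n * ((n + k * t : ℕ) : ℂ) ^ j := by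
      have e1 := h.1 (n + k * t)
      have e2 := h'.1 (n + k * t)
      rw [e1] at e2
      refine (Finset.sum_congr rfl fun j hj => ?_).trans (e2.trans
        (Finset.sum_congr rfl fun j hj => ?_))
      · rw [h.apply_add_mul (Nat.lt_succ_iff.1 (Finset.mem_range.1 hj))]
      · rw [h'.apply_add_mul (Nat.lt_succ_iff.1 (Finset.mem_range.1 hj))]
    rw [Polynomial.IsRoot.def, hp, Polynomial.eval_finsetSum]
    simp only [Polynomial.eval_monomial, sub_mul, Finset.sum_sub_distrib, h1, sub_self]
  have hp0 : p = 0 := by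
    refine Polynomial.eq_zero_of_infinite_isRoot p (Set.infinite_of_injective_forall_mem
      (f := fun k : ℕ => ((n + k * t : ℕ) : ℂ)) (fun a b hab => ?_) hroot)
    have : n + a * t = n + b * t := Nat.cast_injective (R := ℂ) hab
    exact Nat.eq_of_mul_eq_mul_right ht (by omega)
  have hc : p.coeff i = f i n - f' i n := by
    rw [hp, Polynomial.finsetSum_coeff, Finset.sum_eq_single i]
    · simp
    · intro j _ hj
      exact Polynomial.coeff_monomial_of_ne _ hj.symm
    · intro hcon
      exact absurd (Finset.mem_range.2 (Nat.lt_succ_iff.2 hi)) hcon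
  rw [hp0, Polynomial.coeff_zero] at hc
  exact sub_eq_zero.1 hc.symm

theorem isQuasiPolynomialWith_add_pow_mul {d j t : ℕ} (hj : j ≤ d) (ε : ℂ) {u : ℕ → ℂ}
    (hu : ∀ n, u (n + t) = u n) :
    IsQuasiPolynomialWith (fun n => ((n : ℂ) + ε) ^ j * u n) d t
      (fun i n => (j.choose i : ℂ) * ε ^ (j - i) * u n) := by
  refine ⟨fun n => ?_, fun i _ n => by simp only [hu]⟩
  have h1 : ∑ i ∈ Finset.range (d + 1), (j.choose i : ℂ) * ε ^ (j - i) * u n * (n : ℂ) ^ i =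
      ∑ i ∈ Finset.range (j + 1), (j.choose i : ℂ) * ε ^ (j - i) * u n * (n : ℂ) ^ i := by
    refine (Finset.sum_subset (Finset.range_mono (by omega)) fun i _ hi => ?_).symm
    rw [Nat.choose_eq_zero_of_lt (by simpa using hi)]
    simp
  rw [h1]
  simp only [add_pow, Finset.sum_mul]
  exact Finset.sum_congr rfl fun i _ => by ring

end QuasiPolynomial

theorem exists_isQuasiPolynomialWith_of_mem_expSpan {E : Type*} [AddCommGroup E] [Module ℝ E]
    [FiniteDimensional ℝ E] {S : Finset E} {l : E →ₗ[ℝ] ℝ} {t : ℕ}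
    (hl : ∀ v ∈ S, ∃ z : ℤ, (t : ℝ) * l v = 2 * Real.pi * z) (ε : ℝ) {g : ℝ → ℂ}
    (hg : g ∈ expSpan S l) :
    ∃ f, IsQuasiPolynomialWith (fun n : ℕ => g (n + ε)) (Module.finrank ℝ E) t f ∧
      ∀ i n, f i n ≠ 0 → ∃ T, IsSubface S T ∧ vectorSpan ℝ (T : Set E) ≤ LinearMap.ker l ∧
        Module.finrank ℝ (vectorSpan ℝ (T : Set E)) = i := by
  induction hg using Submodule.span_induction with
  | mem g hg =>
    obtain ⟨T, v, hT, hker, hv, rfl⟩ := hg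
    set j := Module.finrank ℝ (vectorSpan ℝ (T : Set E)) with hj
    obtain ⟨z, hz⟩ := hl v hv
    have hu : ∀ n : ℕ, Complex.exp (Complex.I * ((((n + t : ℕ) : ℝ) + ε) * l v : ℝ)) =
        Complex.exp (Complex.I * (((n : ℝ) + ε) * l v : ℝ)) := by
      intro n
      have : Complex.I * ((((n + t : ℕ) : ℝ) + ε) * l v : ℝ) =
          Complex.I * (((n : ℝ) + ε) * l v : ℝ) + z * (2 * Real.pi * Complex.I) := by
        have h1 : (((n + t : ℕ) : ℝ) + ε) * l v = ((n : ℝ) + ε) * l v + 2 * Real.pi * z := by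
          rw [← hz]; push_cast; ring
        rw [h1]; push_cast; ring
      rw [this, Complex.exp_add, Complex.exp_int_mul_two_pi_mul_I, mul_one]
    have hq := isQuasiPolynomialWith_add_pow_mul (d := Module.finrank ℝ E)
      (Submodule.finrank_le (vectorSpan ℝ (T : Set E))) (ε : ℂ)
      (u := fun n => Complex.exp (Complex.I * (((n : ℝ) + ε) * l v : ℝ))) hu
    refine ⟨_, by simpa using hq, fun i n hne => ?_⟩
    have hij : i ≤ j := by
      by_contra! h
      exact hne (by simp [← hj, Nat.choose_eq_zero_of_lt h])
    -- The binomial expansion produces powers below `j`; each is accounted for by a smaller face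
    -- inside `T`.
    obtain ⟨U, hU, hUT, hUi⟩ := hT.exists_finrank_eq hij
    exact ⟨U, hU, (vectorSpan_mono ℝ (Finset.coe_subset.2 hUT)).trans hker, hUi⟩
  | zero => exact ⟨0, ⟨by simp, by simp⟩, by simp⟩
  | add g g' _ _ ih ih' =>
    obtain ⟨f, hf, hf0⟩ := ih
    obtain ⟨f', hf', hf0'⟩ := ih'
    refine ⟨f + f', hf.add hf', fun i n hne => ?_⟩
    by_cases h : f i n = 0
    · exact hf0' i n fun h' => hne (by simp [h, h'])
    · exact hf0 i n h
  | smul c g _ ih =>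
    obtain ⟨f, hf, hf0⟩ := ih
    exact ⟨c • f, hf.smul c, fun i n hne => hf0 i n fun h => hne (by simp [h])⟩

/-! ### Lattice points, dilation and the conclusion. -/

/-- A rational polytope is the convex hull of finitely many points of `t⁻¹ • Λ`. -/
theorem IsLatticePolytope.exists_finset {V : Type*} [NormedAddCommGroup V] [NormedSpace ℝ V]
    [FiniteDimensional ℝ V] {Λ : Submodule ℤ V} {P : Set V} {t : ℕ} (ht : 0 < t)
    (h : IsLatticePolytope Λ ((t : ℝ) • P)) :
    ∃ S : Finset V, P = convexHull ℝ (S : Set V) ∧ ∀ v ∈ S, (t : ℝ) • v ∈ Λ := by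
  classical
  obtain ⟨⟨S₀, -, hS₀⟩, hext⟩ := h
  have ht0 : (t : ℝ) ≠ 0 := by exact_mod_cast ht.ne'
  have hfin : (((t : ℝ) • P).extremePoints ℝ).Finite := by
    rw [hS₀]
    exact S₀.finite_toSet.subset extremePoints_convexHull_subset
  have hhull : convexHull ℝ (((t : ℝ) • P).extremePoints ℝ) = (t : ℝ) • P := by
    have h1 : IsCompact ((t : ℝ) • P) := by
      rw [hS₀]; exact isCompact_convexHull_finset S₀
    have h2 : Convex ℝ ((t : ℝ) • P) := by
      rw [hS₀]; exact convex_convexHull ℝ _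
    rw [← (hfin.isCompact_convexHull ℝ).isClosed.closure_eq]
    exact closure_convexHull_extremePoints h1 h2
  refine ⟨hfin.toFinset.image fun v => (t : ℝ)⁻¹ • v, ?_, fun v hv => ?_⟩
  · rw [Finset.coe_image, hfin.coe_toFinset, Set.image_smul, convexHull_smul, hhull,
      inv_smul_smul₀ ht0]
  · obtain ⟨w, hw, rfl⟩ := Finset.mem_image.1 hv
    rw [smul_inv_smul₀ ht0]
    exact hext (hfin.mem_toFinset.1 hw)

theorem expValuation_smul_add_singleton {V : Type*} [NormedAddCommGroup V] [InnerProductSpace ℝ V]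
    [FiniteDimensional ℝ V] [MeasurableSpace V] [BorelSpace V] {P : Set V} (hP : P.Nonempty)
    (l a : V) {s : ℝ} (hs : 0 ≤ s) :
    expValuation l (s • P + {a}) = Complex.exp (Complex.I * ((2 * Real.pi * inner ℝ l a : ℝ) : ℂ)) *
      ((s : ℂ) ^ Module.finrank ℝ V * ∫ x in P,
        Complex.exp (Complex.I * ((s * (2 * Real.pi * inner ℝ l x) : ℝ) : ℂ))) := by
  have htrans : expValuation l (s • P + {a}) =
      Complex.exp (Complex.I * ((2 * Real.pi * inner ℝ l a : ℝ) : ℂ)) *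
      ∫ x in s • P, Complex.exp (Complex.I * ((2 * Real.pi * inner ℝ l x : ℝ) : ℂ)) := by
    have hmp := measurePreserving_add_right (volume : Measure V) a
    have hset : s • P + {a} = (fun x => x + a) '' (s • P) := by
      rw [Set.add_singleton]
    rw [expValuation, hset,
      hmp.setIntegral_image_emb (MeasurableEquiv.addRight a).measurableEmbedding,
      ← integral_const_mul]
    refine integral_congr_ae (Filter.Eventually.of_forall fun x => ?_)
    simp only [← Complex.exp_add, inner_add_right]
    push_cast
    ring_nf
  rw [htrans]
  congr 1
  rcases hs.eq_or_lt with rfl | hs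
  -- This case occurs at `n = 0`, `ε = 0`: the dilate is a point, of measure zero except in
  -- dimension `0`, where `s^0 = 1`.
  · rw [Set.zero_smul_set hP]
    rcases subsingleton_or_nontrivial V with hV | hV
    · have hP' : P = 0 := by
        obtain ⟨x, hx⟩ := hP
        rw [Subsingleton.elim x 0] at hx
        ext y
        rw [Subsingleton.elim y 0]
        simpa using hx
      rw [hP', Module.finrank_zero_iff.2 hV, pow_zero, one_mul]
      refine integral_congr_ae (Filter.Eventually.of_forall fun x => ?_)
      simp [Subsingleton.elim x 0]
    · rw [Complex.ofReal_zero, zero_pow Module.finrank_pos.ne', zero_mul]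
      exact setIntegral_measure_zero _ (measure_singleton (0 : V))
  · have h1 := Measure.setIntegral_comp_smul_of_pos (volume : Measure V)
      (fun x => Complex.exp (Complex.I * ((2 * Real.pi * inner ℝ l x : ℝ) : ℂ))) P hs
    simp only [inner_smul_right] at h1
    have h2 : ∀ x, s * (2 * Real.pi * inner ℝ l x) = 2 * Real.pi * (s * inner ℝ l x) :=
      fun x => by ring
    simp only [h2]
    rw [h1, Complex.real_smul]
    push_cast
    rw [mul_inv_cancel_left₀ (pow_ne_zero _ (by exact_mod_cast hs.ne'))]

theorem theorem3p2 {V : Type*} [NormedAddCommGroup V] [InnerProductSpace ℝ V]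
    [FiniteDimensional ℝ V] [MeasurableSpace V] [BorelSpace V]
    (Λ : Submodule ℤ V) [DiscreteTopology Λ] [IsZLattice ℝ Λ]
    (d : ℕ) (hd : Module.finrank ℝ V = d)
    (P : Set V) (hP : IsRationalPolytope Λ P) (hfull : IsFullDimensional P)
    (t : ℕ) (ht : 0 < t) (htP : IsLatticePolytope Λ ((t : ℝ) • P))
    (ε : ℚ) (hε : 0 ≤ ε) (a : V) (l : V) (hl : l ∈ dualLattice Λ) :
    (∃ f : ℕ → ℕ → ℂ,
      IsQuasiPolynomialWith
        (fun n : ℕ => expValuation l (((n : ℝ) + (ε : ℝ)) • P + {a})) d t f) ∧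
    ∀ f : ℕ → ℕ → ℂ,
      IsQuasiPolynomialWith
        (fun n : ℕ => expValuation l (((n : ℝ) + (ε : ℝ)) • P + {a})) d t f →
      ∀ k ≤ d, (∃ n : ℕ, f (d - k) n ≠ 0) →
        ∃ F : Set V, IsFace P F ∧ Module.finrank ℝ (linSpace F) = d - k ∧
          l ∈ (linSpace F)ᗮ := by
  obtain ⟨S, rfl, hSΛ⟩ := htP.exists_finset ht
  have hPne : (convexHull ℝ (S : Set V)).Nonempty := by
    obtain ⟨⟨S', hS', hPS'⟩, -⟩ := hP
    rw [hPS']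
    exact hS'.to_set.convexHull
  set L : V →ₗ[ℝ] ℝ := (2 * Real.pi) • innerₗ V l with hL
  have hLx : ∀ x, L x = 2 * Real.pi * inner ℝ l x := fun x => rfl
  have hLS : ∀ v ∈ S, ∃ z : ℤ, (t : ℝ) * L v = 2 * Real.pi * z := by
    intro v hv
    obtain ⟨z, hz⟩ := (mem_dualLattice_iff Λ l).1 hl _ (hSΛ v hv)
    refine ⟨z, ?_⟩
    rw [hz, hLx, inner_smul_right]
    ring
  have hmem := Submodule.smul_mem _ (Complex.exp (Complex.I * (L a : ℝ)))
    (pow_mul_setIntegral_mem_expSpan d (volume : Measure V) hd S L)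
  obtain ⟨f, hf, hface⟩ := exists_isQuasiPolynomialWith_of_mem_expSpan hLS (ε : ℝ) hmem
  have hfun : (fun n : ℕ => expValuation l
      (((n : ℝ) + (ε : ℝ)) • convexHull ℝ (S : Set V) + {a})) = fun n : ℕ =>
      (Complex.exp (Complex.I * (L a : ℝ)) • fun s : ℝ => (s : ℂ) ^ d *
        ∫ x in convexHull ℝ (S : Set V), Complex.exp (Complex.I * (s * L x : ℝ)))
        ((n : ℝ) + (ε : ℝ)) := by
    funext n
    have hε' : (0 : ℝ) ≤ ε := by exact_mod_cast hε
    rw [expValuation_smul_add_singleton hPne l a (by positivity), hd]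
    rfl
  rw [hd] at hf
  rw [hfun]
  refine ⟨⟨f, hf⟩, fun f' hf' k hk ⟨n, hn⟩ => ?_⟩
  rw [hf'.unique ht hf (Nat.sub_le d k)] at hn
  obtain ⟨T, hT, hker, hdim⟩ := hface _ _ hn
  refine ⟨_, hT.isFace, ?_, ?_⟩
  · rw [linSpace_convexHull, hdim]
  · rw [linSpace_convexHull, Submodule.mem_orthogonal']
    intro x hx
    have h1 : 2 * Real.pi * inner ℝ l x = 0 := hker hx
    exact (mul_eq_zero.1 h1).resolve_left Real.two_pi_pos.ne'
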